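/- Let $G$ be the path with $N \ge 1$ vertices $x_1, \dots, x_N$ (so $x_i \sim x_j$ if and only if $|i-j| = 1$) and let $\varepsilon \in [0,1]$. Consider the continuous-time Markov process $\eta_t : \{x_1, \dots, x_N\} \to [0,1]$ with generator $$ L g(\eta) = \sum_{x} \sum_{y \sim x} \mathbf{1}\{|\eta(y) - \eta(x)| < \varepsilon\}\,[g(\eta_{x \to y}) - g(\eta)], $$ where $\eta_{x \to y}$ is obtained from $\eta$ by assigning the value $\eta(x)$ to the vertex $y$; that is, each ordered pair $(x,y)$ of neighbours becomes active at rate $1$, independently of the others, and then $y$ adopts the opinion of $x$ provided that the two opinions differ by less than $\varepsilon$. Let $P_\varepsilon$ be the law of this process when the initial opinions $\eta_0(x_i)$, $1 \le i \le N$, are independent and uniformly distributed on $[0,1]$, and let $$ \nu_\varepsilon(G) = \lim_{t \to \infty} \operatorname{card}\{\eta_t(x_i) : 1 \le i \le N\} $$ be the limiting number of distinct opinions. Then there exist constants $c_1, c_2 > 0$ that depend neither on $N$ nor on $\varepsilon$ such that, for all $N \ge 1$ and all $\varepsilon \in [0,1]$, $$ P_\varepsilon\big(\nu_\varepsilon(G)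 < (1 - c_1 \varepsilon) N\big) \le \exp(-c_2\, \varepsilon N). $$ -/

import Mathlib

open MeasureTheory ProbabilityTheory Filter Topology

namespace OpinionDynamics

noncomputable section

instance isProbabilityMeasure_expMeasure_one : IsProbabilityMeasure (expMeasure 1) :=
  isProbabilityMeasure_expMeasure one_pos

/-- A configuration: each vertex carries an opinion in `[0, 1]`. -/
abbrev Config (V : Type*) : Type _ := V → unitInterval

/-- A realization of the randomness: the initial opinions, and for each ordered pair of neighbours
`d` and each `n` the waiting time between the `n`-th and the `(n+1)`-st ring of the clock of `d`. -/
abbrev Sample {V : Type*} (G : SimpleGraph V) : Type _ :=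
  Config V × (G.Dart × ℕ → ℝ)

/-- The initial opinions are i.i.d. uniform on `[0, 1]`; the waiting times are i.i.d. exponential
with parameter `1` (so the clocks of the ordered pairs of neighbours are independent rate `1`
Poisson processes) and independent of the initial opinions. -/
def law {V : Type*} [Fintype V] (G : SimpleGraph V) : Measure (Sample G) :=
  (Measure.pi fun _ : V => (volume : Measure unitInterval)).prod
    (Measure.infinitePi fun _ : G.Dart × ℕ => expMeasure 1)

instance isProbabilityMeasure_law {V : Type*} [Fintype V] (G : SimpleGraph V) :
    IsProbabilityMeasure (law G) := by
  unfold law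
  infer_instance

/-- The pair `d = (x, y)` becomes active: `y` adopts the opinion of `x` provided that the distance
between the two opinions is less than the confidence threshold `ε`. -/
def interact {V : Type*} [DecidableEq V] {G : SimpleGraph V} (ε : ℝ) (η : Config V) (d : G.Dart) :
    Config V :=
  if |(η d.snd : ℝ) - (η d.fst : ℝ)| < ε then Function.update η d.snd (η d.fst) else η

/-- The time of ring number `n + 1` of the clock of `d`. -/
def ringTime {V : Type*} {G : SimpleGraph V} (ω : Sample G) (d : G.Dart) (n : ℕ) : ℝ :=
  ∑ k ∈ Finset.range (n + 1), ω.2 (d, k)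

/-- The times at which some clock rings, in increasing order, preceded by time `0`. -/
def updateTime {V : Type*} {G : SimpleGraph V} (ω : Sample G) : ℕ → ℝ
  | 0 => 0
  | k + 1 => sInf {t : ℝ | updateTime ω k < t ∧ ∃ (d : G.Dart) (n : ℕ), ringTime ω d n = t}

open Classical in
/-- The configuration after the first `k` rings. Almost surely the pair whose clock rings at
`updateTime ω (k + 1)` exists (if `G` has an edge) and is unique. -/
def configAfter {V : Type*} [DecidableEq V] {G : SimpleGraph V} (ε : ℝ) (ω : Sample G) :
    ℕ → Config V
  | 0 => ω.1
  | k + 1 =>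
    if h : ∃ d : G.Dart, ∃ n : ℕ, ringTime ω d n = updateTime ω (k + 1) then
      interact ε (configAfter ε ω k) h.choose
    else configAfter ε ω k

/-- The number of rings up to and including time `t` (almost surely finite). -/
def numUpdates {V : Type*} {G : SimpleGraph V} (ω : Sample G) (t : ℝ) : ℕ :=
  Set.ncard {k : ℕ | updateTime ω (k + 1) ≤ t}

/-- The continuous-time opinion process `η_t` with confidence threshold `ε`, that is, the Markov
jump process with generator
`L g (η) = ∑ x, ∑ y ~ x, 1{|η y - η x| < ε} (g (η_{x → y}) - g η)`. -/
def opinionProcess {V : Type*} [DecidableEq V] {G : SimpleGraph V} (ε : ℝ) (t : ℝ) (ω : Sample G) :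
    Config V :=
  configAfter ε ω (numUpdates ω t)

/-- The number of distinct opinions in a configuration. -/
def numOpinions {V : Type*} (η : Config V) : ℕ := (Set.range η).ncard

/-- The limiting number of opinions, as time goes to infinity. -/
def limitNumOpinions {V : Type*} [DecidableEq V] (G : SimpleGraph V) (ε : ℝ) (ω : Sample G) : ℕ :=
  limUnder atTop fun t : ℝ => numOpinions (opinionProcess ε t ω)

lemma numOpinions_interact_le {V : Type*} [DecidableEq V] [Finite V] {G : SimpleGraph V} (ε : ℝ)
    (η : Config V) (d : G.Dart) : numOpinions (interact ε η d) ≤ numOpinions η := by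
  unfold numOpinions
  apply Set.ncard_le_ncard _ (Set.finite_range η)
  unfold interact
  split_ifs
  · rintro _ ⟨z, rfl⟩
    by_cases hz : z = d.snd
    · subst hz; simp
    · simp [Function.update_of_ne hz]
  · exact le_rfl

lemma antitone_numOpinions_configAfter {V : Type*} [DecidableEq V] [Finite V] {G : SimpleGraph V}
    (ε : ℝ) (ω : Sample G) : Antitone fun k => numOpinions (configAfter ε ω k) := by
  refine antitone_nat_of_succ_le fun k => ?_
  simp only [configAfter]
  split_ifs
  · exact numOpinions_interact_le _ _ _
  · exact le_rfl

/-- The limit that defines `limitNumOpinions` exists for every realization. -/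
theorem tendsto_numOpinions {V : Type*} [DecidableEq V] [Finite V] (G : SimpleGraph V)
    (ε : ℝ) (ω : Sample G) :
    Tendsto (fun t : ℝ => numOpinions (opinionProcess ε t ω)) atTop
      (𝓝 (limitNumOpinions G ε ω)) := by
  apply tendsto_nhds_limUnder
  by_cases H : ∀ t, {k : ℕ | updateTime ω (k + 1) ≤ t}.Finite
  · refine ⟨_, tendsto_atTop_ciInf (fun s t hst => ?_) (OrderBot.bddBelow _)⟩
    exact antitone_numOpinions_configAfter ε ω
      (Set.ncard_le_ncard (fun k hk => le_trans hk hst) (H t))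
  · push Not at H
    obtain ⟨t₀, h₀⟩ := H
    refine ⟨numOpinions ω.1, tendsto_const_nhds.congr' ?_⟩
    filter_upwards [eventually_ge_atTop t₀] with t ht
    have hinf : {k : ℕ | updateTime ω (k + 1) ≤ t}.Infinite :=
      Set.Infinite.mono (fun k hk => le_trans hk ht) h₀
    simp [opinionProcess, numUpdates, hinf.ncard, configAfter]

end

end OpinionDynamics

open MeasureTheory ProbabilityTheory Filter Topology

namespace OpinionDynamics

noncomputable section

/-! ### A potential that interactions never decrease -/

/-! The bound is deterministic given the initial opinions. Give an interface weight `0` if its ends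
agree, `1` if they differ by at least `4ε`, and otherwise a value rising linearly from `-1` with
slope `1/(2ε)`. An active pair deletes an interface shorter than `ε`, whose weight is then at most
`-1/2`, and shifts one end of the next interface by less than `ε`, which costs less than `1/2`. So
the total weight never drops (`pathWeight_le_interact`), whatever the clocks do.

Almost surely the initial opinions are distinct; each opinion then always occupies an interval, and
the number of opinions is at least total weight plus one
(`HasIntervalLevels.pathWeight_add_one_le`). Initially the weight is at least the number of edges
minus twice the number of edges shorter than `4ε`. An exponential moment shows that this last number
exceeds a multiple of `εN` only with exponentially small probability (`measure_le_closePairs_le`).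
-/

/-- The weight of an interface between the opinions `x` and `y`. Merging two neighbouring interfaces
one of which is shorter than `ε` does not decrease the total weight. -/
def interfaceWeight (ε x y : ℝ) : ℝ :=
  if x = y then 0 else 1 - 2 * max 0 (1 - |x - y| / (4 * ε))

lemma interfaceWeight_self (ε x : ℝ) : interfaceWeight ε x x = 0 := by simp [interfaceWeight]

lemma interfaceWeight_comm (ε x y : ℝ) : interfaceWeight ε x y = interfaceWeight ε y x := by
  simp [interfaceWeight, eq_comm, abs_sub_comm]

lemma interfaceWeight_le_one (ε x y : ℝ) : interfaceWeight ε x y ≤ 1 := by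
  unfold interfaceWeight
  split_ifs
  · exact zero_le_one
  · linarith [le_max_left 0 (1 - |x - y| / (4 * ε))]

lemma interfaceWeight_of_lt {ε x y : ℝ} (h : |x - y| < ε) (hxy : x ≠ y) :
    interfaceWeight ε x y = -1 + 2 * (|x - y| / (4 * ε)) := by
  have hε : 0 < ε := (abs_nonneg _).trans_lt h
  have : |x - y| / (4 * ε) ≤ 1 := by rw [div_le_one (by positivity)]; linarith
  rw [interfaceWeight, if_neg hxy, max_eq_right (by linarith)]
  ring

lemma interfaceWeight_nonpos {ε x y : ℝ} (h : |x - y| < ε) : interfaceWeight ε x y ≤ 0 := by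
  have hε : 0 < ε := (abs_nonneg _).trans_lt h
  by_cases hxy : x = y
  · simp [interfaceWeight, hxy]
  have : |x - y| / (4 * ε) ≤ 1 / 4 := by rw [div_le_iff₀ (by positivity)]; linarith
  rw [interfaceWeight_of_lt h hxy]
  linarith

lemma interfaceWeight_add_le {ε x y : ℝ} (h : |x - y| < ε) (z : ℝ) :
    interfaceWeight ε x y + interfaceWeight ε y z ≤ interfaceWeight ε x z := by
  have hε : 0 < ε := (abs_nonneg _).trans_lt h
  rcases eq_or_ne x y with rfl | hxy
  · simp [interfaceWeight_self]
  rcases eq_or_ne y z with rfl | hyz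
  · simp [interfaceWeight_self]
  rcases eq_or_ne x z with rfl | hxz
  · rw [interfaceWeight_self, interfaceWeight_comm ε y x]
    linarith [interfaceWeight_nonpos h]
  have hq : |x - y| / (4 * ε) ≤ 1 / 4 := by rw [div_le_iff₀ (by positivity)]; linarith
  -- The width `4ε` is tight: replacing `y` by `x` costs at most `|x - y|/(2ε)`, and `-1 + 2 * |x -
  -- y|/(2ε) ≤ 0` as long as `|x - y| ≤ ε`.
  have htri : |y - z| / (4 * ε) ≤ |x - y| / (4 * ε) + |x - z| / (4 * ε) := by
    rw [← add_div]
    gcongr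
    rw [abs_sub_comm x y]
    exact abs_sub_le y x z
  have hmax : max 0 (1 - |x - z| / (4 * ε)) ≤
      |x - y| / (4 * ε) + max 0 (1 - |y - z| / (4 * ε)) := by
    have h0 := le_max_left 0 (1 - |y - z| / (4 * ε))
    have h1 := le_max_right 0 (1 - |y - z| / (4 * ε))
    have h2 : 0 ≤ |x - y| / (4 * ε) := by positivity
    exact max_le (by linarith) (by linarith)
  rw [interfaceWeight_of_lt h hxy]
  simp only [interfaceWeight, if_neg hyz, if_neg hxz]
  linarith

/-- The total weight of the interfaces of a configuration on the path. -/
def pathWeight {n : ℕ} (ε : ℝ) (η : Config (Fin (n + 1))) : ℝ :=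
  ∑ i : Fin n, interfaceWeight ε (η i.castSucc) (η i.succ)

lemma dart_cases {n : ℕ} (d : (SimpleGraph.pathGraph (n + 1)).Dart) :
    ∃ j : Fin n, (d.fst = j.castSucc ∧ d.snd = j.succ) ∨ (d.fst = j.succ ∧ d.snd = j.castSucc) := by
  rcases SimpleGraph.pathGraph_adj.1 d.adj with h | h
  · exact ⟨⟨d.fst, by omega⟩, .inl ⟨rfl, Fin.ext h.symm⟩⟩
  · exact ⟨⟨d.snd, by omega⟩, .inr ⟨Fin.ext h.symm, rfl⟩⟩

lemma pathWeight_le_update_succ {n : ℕ} {ε : ℝ} (η : Config (Fin (n + 1))) (j : Fin n)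
    (h : |(η j.castSucc : ℝ) - η j.succ| < ε) :
    pathWeight ε η ≤ pathWeight ε (Function.update η j.succ (η j.castSucc)) := by
  unfold pathWeight
  set η' := Function.update η j.succ (η j.castSucc) with hη'
  have hne : ∀ k, k ≠ j.succ → η' k = η k := fun k hk => Function.update_of_ne hk _ _
  have hj : η' j.succ = η j.castSucc := by simp [hη']
  have hjc : η' j.castSucc = η j.castSucc := hne _ (by simp [Fin.ext_iff])
  -- An interior vertex touches two interfaces; the last vertex touches only one, whose nonpositive
  -- weight becomes `0`.
  by_cases hlast : (j : ℕ) + 1 < n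
  · let k : Fin n := ⟨j + 1, hlast⟩
    have hkj : k ≠ j := by simp [k, Fin.ext_iff]
    have hkc : k.castSucc = j.succ := by ext; simp [k]
    rw [← Finset.add_sum_erase _ _ (Finset.mem_univ j),
      ← Finset.add_sum_erase _ _ (Finset.mem_erase.2 ⟨hkj, Finset.mem_univ k⟩),
      ← Finset.add_sum_erase _ (fun i : Fin n => interfaceWeight ε (η' i.castSucc) (η' i.succ))
        (Finset.mem_univ j),
      ← Finset.add_sum_erase _ (fun i : Fin n => interfaceWeight ε (η' i.castSucc) (η' i.succ))
        (Finset.mem_erase.2 ⟨hkj, Finset.mem_univ k⟩)]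
    have hrest : ∑ i ∈ (Finset.univ.erase j).erase k, interfaceWeight ε (η i.castSucc) (η i.succ) =
        ∑ i ∈ (Finset.univ.erase j).erase k, interfaceWeight ε (η' i.castSucc) (η' i.succ) := by
      refine Finset.sum_congr rfl fun i hi => ?_
      simp only [Finset.mem_erase, Finset.mem_univ, and_true] at hi
      rw [hne, hne]
      · simpa using hi.2
      · rw [← hkc]; simpa using hi.1
    have hks : η' k.succ = η k.succ := hne _ (by simpa using hkj)
    have := interfaceWeight_add_le h (η k.succ)
    simp only [hrest, hkc, hj, hjc, hks, interfaceWeight_self]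
    linarith
  · rw [← Finset.add_sum_erase _ _ (Finset.mem_univ j),
      ← Finset.add_sum_erase _ (fun i : Fin n => interfaceWeight ε (η' i.castSucc) (η' i.succ))
        (Finset.mem_univ j)]
    have hrest : ∑ i ∈ Finset.univ.erase j, interfaceWeight ε (η i.castSucc) (η i.succ) =
        ∑ i ∈ Finset.univ.erase j, interfaceWeight ε (η' i.castSucc) (η' i.succ) := by
      refine Finset.sum_congr rfl fun i hi => ?_
      simp only [Finset.mem_erase, Finset.mem_univ, and_true] at hi
      rw [hne, hne]
      · simpa using hi
      · simp only [ne_eq, Fin.ext_iff, Fin.val_castSucc, Fin.val_succ]; omega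
    have := interfaceWeight_nonpos h
    simp only [hrest, hj, hjc, interfaceWeight_self]
    linarith

lemma pathWeight_comp_rev {n : ℕ} (ε : ℝ) (η : Config (Fin (n + 1))) :
    pathWeight ε (η ∘ Fin.rev) = pathWeight ε η := by
  unfold pathWeight
  rw [← Equiv.sum_comp Fin.revPerm]
  refine Finset.sum_congr rfl fun i _ => ?_
  simp only [Function.comp, Fin.revPerm_apply, Fin.rev_castSucc, Fin.rev_succ, Fin.rev_rev]
  exact interfaceWeight_comm _ _ _

lemma pathWeight_le_update_castSucc {n : ℕ} {ε : ℝ} (η : Config (Fin (n + 1))) (j : Fin n)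
    (h : |(η j.succ : ℝ) - η j.castSucc| < ε) :
    pathWeight ε η ≤ pathWeight ε (Function.update η j.castSucc (η j.succ)) := by
  have hrev := pathWeight_le_update_succ (ε := ε) (η ∘ Fin.rev) j.rev
    (by simpa [← Fin.rev_succ, ← Fin.rev_castSucc] using h)
  rw [pathWeight_comp_rev] at hrev
  refine hrev.trans_eq ?_
  rw [← pathWeight_comp_rev ε (Function.update η j.castSucc (η j.succ))]
  congr 1
  ext k
  simp only [Function.comp, ← Fin.rev_succ, ← Fin.rev_castSucc, Fin.rev_rev, Function.update_apply,
    Fin.rev_eq_iff]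

lemma pathWeight_le_interact {n : ℕ} (ε : ℝ) (η : Config (Fin (n + 1)))
    (d : (SimpleGraph.pathGraph (n + 1)).Dart) : pathWeight ε η ≤ pathWeight ε (interact ε η d) := by
  unfold interact
  split_ifs with h
  · rw [abs_sub_comm] at h
    obtain ⟨j, ⟨h1, h2⟩ | ⟨h1, h2⟩⟩ := dart_cases d <;> rw [h1, h2] at h ⊢
    · exact pathWeight_le_update_succ η j h
    · exact pathWeight_le_update_castSucc η j h
  · exact le_rfl

/-! ### The opinions occupy intervals -/

/-- Each opinion is held by a set of consecutive vertices. -/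
def HasIntervalLevels {n : ℕ} (η : Config (Fin n)) : Prop :=
  ∀ i j k, i ≤ j → j ≤ k → η i = η k → η j = η k

lemma HasIntervalLevels.comp {n : ℕ} {η : Config (Fin n)} (h : HasIntervalLevels η)
    {σ : Fin n → Fin n} (hσ : Monotone σ) : HasIntervalLevels (η ∘ σ) :=
  fun _ _ _ hij hjk => h _ _ _ (hσ hij) (hσ hjk)

lemma hasIntervalLevels_of_injective {n : ℕ} {η : Config (Fin n)} (h : Function.Injective η) :
    HasIntervalLevels η := fun i j k hij hjk hik => by
  have := h hik
  rw [le_antisymm hjk (this ▸ hij)]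

/-- Copying along an edge is precomposition with a map of the path that is monotone because no
vertex lies strictly between the two endpoints. -/
lemma HasIntervalLevels.interact {n : ℕ} {η : Config (Fin (n + 1))} (h : HasIntervalLevels η)
    (ε : ℝ) (d : (SimpleGraph.pathGraph (n + 1)).Dart) :
    HasIntervalLevels (interact ε η d) := by
  unfold OpinionDynamics.interact
  split_ifs
  · have hcomp : Function.update η d.snd (η d.fst) = η ∘ Function.update id d.snd d.fst := by
      rw [Function.comp_update, Function.comp_id]
    rw [hcomp]
    refine h.comp fun a b hab => ?_
    have hadj := SimpleGraph.pathGraph_adj.1 d.adj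
    simp only [Function.update_apply, id]
    split_ifs <;> simp only [Fin.le_def, Fin.ext_iff] at * <;> omega
  · exact h

lemma HasIntervalLevels.pathWeight_add_one_le {n : ℕ} {η : Config (Fin (n + 1))}
    (h : HasIntervalLevels η) (ε : ℝ) : pathWeight ε η + 1 ≤ numOpinions η := by
  classical
  let C : Finset (Fin n) := {i | η i.castSucc ≠ η i.succ}
  have hweight : pathWeight ε η ≤ C.card := by
    rw [Finset.card_filter, Nat.cast_sum]
    refine Finset.sum_le_sum fun i _ => ?_
    by_cases hi : η i.castSucc = η i.succ
    · simp [hi, interfaceWeight_self]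
    · simpa [hi] using interfaceWeight_le_one ε _ _
  -- The left endpoints of the maximal constant blocks; interval levels force distinct blocks to
  -- carry distinct opinions.
  let S : Finset (Fin (n + 1)) := insert 0 (C.map (Fin.succEmb n))
  have hS : S.card = C.card + 1 := by
    rw [Finset.card_insert_of_notMem (by simp), Finset.card_map]
  have hne : ∀ a ∈ S, ∀ b ∈ S, a < b → η a ≠ η b := by
    intro a _ b hb hab heq
    rcases Finset.mem_insert.1 hb with rfl | hb
    · simp at hab
    obtain ⟨i, hi, rfl⟩ := Finset.mem_map.1 hb
    refine (Finset.mem_filter.1 hi).2 (h a _ _ ?_ ?_ heq)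
    · exact Fin.le_castSucc_iff.2 hab
    · exact (Fin.castSucc_lt_succ).le
  have hinj : Set.InjOn η S := by
    intro a ha b hb heq
    rcases lt_trichotomy a b with hab | hab | hab
    · exact (hne a ha b hb hab heq).elim
    · exact hab
    · exact (hne b hb a ha hab heq.symm).elim
  have hcard : C.card + 1 ≤ numOpinions η := by
    rw [← hS, ← Set.ncard_coe_finset, ← hinj.ncard_image]
    exact Set.ncard_le_ncard (Set.image_subset_range _ _) (Set.finite_range η)
  have : (C.card : ℝ) + 1 ≤ numOpinions η := by exact_mod_cast hcard
  linarith

/-! ### A deterministic bound in terms of the initial opinions -/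

lemma configAfter_spec {n : ℕ} (ε : ℝ) (ω : Sample (SimpleGraph.pathGraph (n + 1)))
    (hω : Function.Injective ω.1) (k : ℕ) :
    HasIntervalLevels (configAfter ε ω k) ∧
      pathWeight ε ω.1 ≤ pathWeight ε (configAfter ε ω k) := by
  induction k with
  | zero => exact ⟨hasIntervalLevels_of_injective hω, le_rfl⟩
  | succ k ih =>
    simp only [configAfter]
    split_ifs
    · exact ⟨ih.1.interact ε _, ih.2.trans (pathWeight_le_interact ε _ _)⟩
    · exact ih

lemma pathWeight_add_one_le_limitNumOpinions {n : ℕ} (ε : ℝ)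
    (ω : Sample (SimpleGraph.pathGraph (n + 1))) (hω : Function.Injective ω.1) :
    pathWeight ε ω.1 + 1 ≤ limitNumOpinions (SimpleGraph.pathGraph (n + 1)) ε ω := by
  have hlim := (continuous_of_discreteTopology (f := ((↑) : ℕ → ℝ))).continuousAt.tendsto.comp
    (tendsto_numOpinions (SimpleGraph.pathGraph (n + 1)) ε ω)
  refine ge_of_tendsto' hlim fun t => ?_
  obtain ⟨h1, h2⟩ := configAfter_spec ε ω hω (numUpdates ω t)
  exact (add_le_add_left h2 1).trans (h1.pathWeight_add_one_le ε)

/-- The number of edges of the path whose endpoints have opinions at distance less than `r`. -/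
def closePairs {n : ℕ} (r : ℝ) (η : Config (Fin (n + 1))) : ℕ :=
  ∑ i : Fin n, if |(η i.castSucc : ℝ) - η i.succ| < r then 1 else 0

lemma sub_closePairs_le_pathWeight {n : ℕ} {ε : ℝ} (hε : 0 < ε) {η : Config (Fin (n + 1))}
    (hη : Function.Injective η) : (n : ℝ) - 2 * closePairs (4 * ε) η ≤ pathWeight ε η := by
  have hn : (n : ℝ) = ∑ _i : Fin n, (1 : ℝ) := by simp
  unfold closePairs pathWeight
  rw [hn, Nat.cast_sum, Finset.mul_sum, ← Finset.sum_sub_distrib]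
  refine Finset.sum_le_sum fun i _ => ?_
  have hne : (η i.castSucc : ℝ) ≠ η i.succ := fun h =>
    (Fin.castSucc_lt_succ (i := i)).ne (hη (Subtype.ext h))
  rw [interfaceWeight, if_neg hne]
  split_ifs with h
  · have h0 : 0 ≤ |(η i.castSucc : ℝ) - η i.succ| / (4 * ε) := by positivity
    have : max 0 (1 - |(η i.castSucc : ℝ) - η i.succ| / (4 * ε)) ≤ 1 :=
      max_le zero_le_one (by linarith)
    push_cast
    linarith
  · have h1 : 1 ≤ |(η i.castSucc : ℝ) - η i.succ| / (4 * ε) := by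
      rw [one_le_div (by positivity)]; exact not_lt.1 h
    rw [max_eq_left (by linarith)]
    simp

/-! ### Independent uniform opinions -/

lemma volume_abs_sub_lt_le (v r : ℝ) :
    volume {u : unitInterval | |(u : ℝ) - v| < r} ≤ ENNReal.ofReal (2 * r) := by
  rw [← volume_image_subtype_coe measurableSet_Icc, ← Real.volume_ball]
  refine measure_mono ?_
  rintro _ ⟨u, hu, rfl⟩
  rw [Real.ball_eq_Ioo]
  have := abs_lt.1 (show |(u : ℝ) - v| < r from hu)
  exact ⟨by linarith, by linarith⟩

lemma measurable_closePairs {n : ℕ} (r : ℝ) :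
    Measurable (closePairs r : Config (Fin (n + 1)) → ℕ) := by
  unfold closePairs
  refine Finset.measurable_sum _ fun i _ => Measurable.ite ?_ measurable_const measurable_const
  exact measurableSet_lt (by fun_prop) measurable_const

/-- Base `3` exceeds `e`, so exponential Markov applies, and `3 = 1 + 2` turns the probability bound
`2r` into `1 + 4r`. -/
lemma lintegral_three_pow_ite_le (v : unitInterval) {r : ℝ} (hr : 0 ≤ r) :
    ∫⁻ u : unitInterval, (3 : ENNReal) ^ (if |(u : ℝ) - v| < r then 1 else 0) ≤
      ENNReal.ofReal (1 + 4 * r) := by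
  have hmeas : MeasurableSet {u : unitInterval | |(u : ℝ) - v| < r} :=
    measurableSet_lt (by fun_prop) measurable_const
  have hpt : ∀ u : unitInterval, (3 : ENNReal) ^ (if |(u : ℝ) - v| < r then 1 else 0) =
      1 + {u : unitInterval | |(u : ℝ) - v| < r}.indicator (fun _ => 2) u := by
    intro u
    by_cases h : |(u : ℝ) - v| < r
    · rw [if_pos h, Set.indicator_of_mem (by exact h)]
      norm_num
    · rw [if_neg h, Set.indicator_of_notMem (by exact h)]
      norm_num
  simp_rw [hpt]
  rw [lintegral_add_left measurable_const, lintegral_indicator_const hmeas, lintegral_one,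
    measure_univ, ENNReal.ofReal_add zero_le_one (by positivity), ENNReal.ofReal_one]
  gcongr
  calc 2 * volume {u : unitInterval | |(u : ℝ) - v| < r}
      ≤ ENNReal.ofReal 2 * ENNReal.ofReal (2 * r) := by
        rw [ENNReal.ofReal_ofNat]
        gcongr
        exact volume_abs_sub_lt_le v r
    _ = ENNReal.ofReal (4 * r) := by
        rw [← ENNReal.ofReal_mul zero_le_two]
        congr 1
        ring

lemma closePairs_cons {n : ℕ} (r : ℝ) (u : unitInterval) (η : Config (Fin (n + 1))) :
    closePairs r (Fin.cons u η : Config (Fin (n + 2))) =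
      (if |(u : ℝ) - η 0| < r then 1 else 0) + closePairs r η := by
  unfold closePairs
  rw [Fin.sum_univ_succ]
  rfl

/-- Neighbouring edges share a vertex, but the one-edge bound is uniform in the opinion at the other
end; integrating out the first vertex therefore gains one factor. -/
lemma lintegral_three_pow_closePairs_le {r : ℝ} (hr : 0 ≤ r) (n : ℕ) :
    ∫⁻ η : Config (Fin (n + 1)), (3 : ENNReal) ^ closePairs r η ≤
      ENNReal.ofReal (1 + 4 * r) ^ n := by
  induction n with
  | zero => simp [closePairs]
  | succ n ih =>
    have hm : ∀ m, Measurable fun η : Config (Fin (m + 1)) => (3 : ENNReal) ^ closePairs r η :=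
      fun m => (measurable_of_countable fun k : ℕ => (3 : ENNReal) ^ k).comp
        (measurable_closePairs r)
    have hmp := (volume_preserving_piFinSuccAbove (fun _ : Fin (n + 2) => unitInterval) 0).symm
    have hcons : ∀ p : unitInterval × Config (Fin (n + 1)),
        (MeasurableEquiv.piFinSuccAbove (fun _ : Fin (n + 2) => unitInterval) 0).symm p =
          Fin.cons p.1 p.2 := fun p => by
      simp [MeasurableEquiv.piFinSuccAbove, Fin.insertNthEquiv]
    rw [← hmp.lintegral_comp (hm (n + 1)), Measure.volume_eq_prod]
    refine (lintegral_prod_symm' _ ((hm (n + 1)).comp hmp.measurable)).trans_le ?_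
    simp_rw [Function.comp, hcons, closePairs_cons, pow_add, pow_one]
    calc ∫⁻ η : Config (Fin (n + 1)), ∫⁻ u : unitInterval,
          (3 : ENNReal) ^ (if |(u : ℝ) - η 0| < r then 1 else 0) * 3 ^ closePairs r η
        ≤ ∫⁻ η : Config (Fin (n + 1)), ENNReal.ofReal (1 + 4 * r) * 3 ^ closePairs r η := by
          refine lintegral_mono fun η => ?_
          rw [lintegral_mul_const' _ _ (by simp)]
          gcongr
          exact lintegral_three_pow_ite_le (η 0) hr
      _ ≤ ENNReal.ofReal (1 + 4 * r) * ENNReal.ofReal (1 + 4 * r) ^ n := by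
          rw [lintegral_const_mul _ (hm n)]
          gcongr
      _ = ENNReal.ofReal (1 + 4 * r) ^ n * ENNReal.ofReal (1 + 4 * r) := mul_comm _ _

lemma ae_injective {V : Type*} [Fintype V] : ∀ᵐ η : Config V, Function.Injective η := by
  have hind : iIndepFun (fun (i : V) (η : Config V) => η i)
      (Measure.pi fun _ : V => (volume : Measure unitInterval)) :=
    iIndepFun_pi (X := fun _ => id) fun _ => aemeasurable_id
  have hpair : ∀ i j : V, i ≠ j → ∀ᵐ η : Config V, η i ≠ η j := by
    intro i j hij
    have hmap := (indepFun_iff_map_prod_eq_prod_map_map (measurable_pi_apply i).aemeasurable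
      (measurable_pi_apply j).aemeasurable).1 (hind.indepFun hij)
    rw [(measurePreserving_eval _ i).map_eq, (measurePreserving_eval _ j).map_eq] at hmap
    have hdiag : ((volume : Measure unitInterval).prod volume) (Set.diagonal unitInterval) = 0 := by
      rw [Measure.measure_prod_null measurableSet_diagonal]
      refine .of_forall fun x => ?_
      have : Prod.mk x ⁻¹' Set.diagonal unitInterval = {x} := by
        ext y
        simp [eq_comm]
      simp [this]
    rw [← hmap, Measure.map_apply (by fun_prop) measurableSet_diagonal] at hdiag
    rw [ae_iff]
    simpa [volume_pi, Set.preimage] using hdiag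
  have hall : ∀ᵐ η : Config V, ∀ i j : V, i ≠ j → η i ≠ η j := by
    rw [ae_all_iff]
    intro i
    rw [ae_all_iff]
    intro j
    by_cases hij : i = j
    · simp [hij]
    · simpa [hij] using hpair i j hij
  filter_upwards [hall] with η hη i j hij
  by_contra hne
  exact hη i j hne hij

lemma measure_le_closePairs_le {r : ℝ} (hr : 0 ≤ r) (a : ℝ) (n : ℕ) :
    volume {η : Config (Fin (n + 1)) | a ≤ closePairs r η} ≤
      ENNReal.ofReal (Real.exp (4 * r * n - a)) := by
  have hpow : ∀ k : ℕ, a ≤ k → ENNReal.ofReal (Real.exp a) ≤ 3 ^ k := by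
    intro k hk
    have : Real.exp a ≤ 3 ^ k :=
      calc Real.exp a ≤ Real.exp k := Real.exp_le_exp.2 hk
        _ = Real.exp 1 ^ k := by rw [← Real.exp_nat_mul, mul_one]
        _ ≤ 3 ^ k := by gcongr; exact Real.exp_one_lt_three.le
    calc ENNReal.ofReal (Real.exp a) ≤ ENNReal.ofReal (3 ^ k) := ENNReal.ofReal_le_ofReal this
      _ = 3 ^ k := by rw [ENNReal.ofReal_pow (by norm_num), ENNReal.ofReal_ofNat]
  have hexp : ENNReal.ofReal (1 + 4 * r) ^ n ≤ ENNReal.ofReal (Real.exp (4 * r * n)) := by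
    rw [← ENNReal.ofReal_pow (by positivity), mul_comm _ (n : ℝ), Real.exp_nat_mul]
    refine ENNReal.ofReal_le_ofReal (pow_le_pow_left₀ (by positivity) ?_ n)
    linarith [Real.add_one_le_exp (4 * r)]
  have hmarkov := mul_meas_ge_le_lintegral (μ := (volume : Measure (Config (Fin (n + 1)))))
    ((measurable_of_countable fun k : ℕ => (3 : ENNReal) ^ k).comp (measurable_closePairs r))
    (ENNReal.ofReal (Real.exp a))
  have hmono : volume {η : Config (Fin (n + 1)) | a ≤ closePairs r η} ≤
      volume {η : Config (Fin (n + 1)) | ENNReal.ofReal (Real.exp a) ≤ 3 ^ closePairs r η} :=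
    measure_mono fun η hη => hpow _ hη
  rw [Real.exp_sub, ENNReal.ofReal_div_of_pos (Real.exp_pos a),
    ENNReal.le_div_iff_mul_le (.inl (by simp [Real.exp_pos])) (.inl ENNReal.ofReal_ne_top), mul_comm]
  calc _ ≤ ENNReal.ofReal (Real.exp a) *
        volume {η : Config (Fin (n + 1)) | ENNReal.ofReal (Real.exp a) ≤ 3 ^ closePairs r η} := by
        gcongr
    _ ≤ _ := hmarkov
    _ ≤ _ := (lintegral_three_pow_closePairs_le hr n).trans hexp

end

end OpinionDynamics

open OpinionDynamics in
theorem theorem4 :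
    ∃ c₁ c₂ : ℝ, 0 < c₁ ∧ 0 < c₂ ∧
      ∀ (N : ℕ) (ε : ℝ), 1 ≤ N → 0 ≤ ε → ε ≤ 1 →
        (OpinionDynamics.law (SimpleGraph.pathGraph N)).real
          {ω | (OpinionDynamics.limitNumOpinions (SimpleGraph.pathGraph N) ε ω : ℝ)
            < (1 - c₁ * ε) * (N : ℝ)}
          ≤ Real.exp (-(c₂ * ε * (N : ℝ))) := by
  -- With `r = 4ε` the moment costs `exp (16εn)`; the threshold `17εN` leaves `exp (-εN)`, and each
  -- close pair costs weight `2`, hence `34`.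
  refine ⟨34, 1, by norm_num, one_pos, fun N ε hN hε0 hε1 => ?_⟩
  -- The weights divide by `ε`; at `ε = 0` the right side is `1`.
  rcases hε0.eq_or_lt with rfl | hε
  · simp
  obtain ⟨n, rfl⟩ : ∃ n, N = n + 1 := ⟨N - 1, by omega⟩
  set B : Set (Config (Fin (n + 1))) :=
    {η | 17 * ε * ((n + 1 : ℕ) : ℝ) ≤ closePairs (4 * ε) η}
  have hB : MeasurableSet B := measurableSet_le measurable_const
    ((measurable_of_countable fun k : ℕ => (k : ℝ)).comp (measurable_closePairs _))
  have hsub : {ω : Sample (SimpleGraph.pathGraph (n + 1)) |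
      (limitNumOpinions (SimpleGraph.pathGraph (n + 1)) ε ω : ℝ)
        < (1 - 34 * ε) * ((n + 1 : ℕ) : ℝ)} ⊆
      Prod.fst ⁻¹' ({η | ¬ Function.Injective η} ∪ B) := by
    intro ω hω
    by_cases hinj : Function.Injective ω.1
    · refine .inr ?_
      have h1 := pathWeight_add_one_le_limitNumOpinions ε ω hinj
      have h2 := sub_closePairs_le_pathWeight hε hinj
      simp only [Set.mem_ofPred_eq, B] at hω ⊢
      push_cast at hω ⊢
      linarith
    · exact .inl hinj
  refine ENNReal.toReal_le_of_le_ofReal (Real.exp_pos _).le ?_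
  calc law (SimpleGraph.pathGraph (n + 1)) _
      ≤ law (SimpleGraph.pathGraph (n + 1)) (Prod.fst ⁻¹' ({η | ¬ Function.Injective η} ∪ B)) :=
        measure_mono hsub
    _ = (volume : Measure (Config (Fin (n + 1)))) ({η | ¬ Function.Injective η} ∪ B) :=
        measurePreserving_fst.measure_preimage
          ((NullMeasurableSet.of_null (ae_iff.1 ae_injective)).union hB.nullMeasurableSet)
    _ ≤ volume B := by
        refine (measure_union_le _ _).trans_eq ?_
        rw [ae_iff.1 ae_injective, zero_add]
    _ ≤ _ := measure_le_closePairs_le (by positivity) _ n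
    _ ≤ _ := by
        refine ENNReal.ofReal_le_ofReal (Real.exp_le_exp.2 ?_)
        push_cast
        nlinarith
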